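/- Let $k$ be a field of characteristic not $2$. For a field $F$ of characteristic not $2$, let $\mathrm{Quat}^*(F)$ be the set of isomorphism classes of quaternion division algebras with center $F$. For a division algebra $D$ with center $F$, a maximal subfield of $D$ is a maximal element among the fields $E$ with $F\subseteq E\subseteq D$; two division algebras with center $F$ are linked if some maximal subfield of one is $F$-isomorphic to a maximal subfield of the other, and weakly isomorphic if they have the same set of $F$-isomorphism classes of maximal subfields. Let $\mathcal D\subset \mathrm{Quat}^*(k)$ be a set whose elements are pairwise linked. Then there exists a field extension $K/k$ such that 1. for every $D\in\mathcal D$ the algebra $D\otimes_k K$ is a division algebra, and the resulting map $\mathcal D\to \mathrm{Quat}^*(K)$, $D\mapsto D\otimes_k K$, is injective; and 2. the algebras $D\otimes_k K$, $D\in\mathcal D$, are pairwise weakly isomorphic. -/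

import Mathlib

universe u

open scoped TensorProduct Quaternion

/-- Two `k`-algebras are identified when they are isomorphic as `k`-algebras. -/
def algIsoSetoid (k : Type u) [Field k] : Setoid (AlgCat.{u} k) where
  r A B := Nonempty (A ≃ₐ[k] B)
  iseqv :=
    { refl := fun _ => ⟨AlgEquiv.refl⟩
      symm := fun ⟨e⟩ => ⟨e.symm⟩
      trans := fun ⟨e⟩ ⟨f⟩ => ⟨e.trans f⟩ }

/-- Isomorphism classes of (associative, unital) `k`-algebras. -/
def AlgClass (k : Type u) [Field k] : Type (u + 1) :=
  Quotient (algIsoSetoid k)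

/-- The isomorphism class of a `k`-algebra. -/
def algClass (k : Type u) [Field k] (A : Type u) [Ring A] [Algebra k A] : AlgClass k :=
  Quotient.mk (algIsoSetoid k) (AlgCat.of k A)

/-- `Quat k`: isomorphism classes of quaternion algebras over a field `k` of characteristic
not 2, i.e. of the algebras `(a, b / k)` with `a, b ∈ kˣ`, generated by `i`, `j` subject to
`i² = a`, `j² = b`, `ij = -ji`. -/
def Quat (k : Type u) [Field k] : Set (AlgClass k) :=
  {c | ∃ a b : k, a ≠ 0 ∧ b ≠ 0 ∧ c = algClass k ℍ[k,a,b]}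

/-- A ring is a division ring if it is nonzero and all its nonzero elements are units. -/
def IsDivision (A : Type u) [Ring A] : Prop :=
  Nontrivial A ∧ ∀ x : A, x ≠ 0 → IsUnit x

/-- `Quat* k`: isomorphism classes of quaternion division algebras over `k`. -/
def QuatStar (k : Type u) [Field k] : Set (AlgClass k) :=
  {c | c ∈ Quat k ∧ ∃ A : AlgCat.{u} k, c = algClass k A ∧ IsDivision A}

/-- The maximal subfields of `A`: the maximal elements among the subfields `E` with
`k ⊆ E ⊆ A`. -/
def IsMaximalSubfield (k : Type u) [Field k] {A : Type u} [Ring A] [Algebra k A]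
    (E : Subalgebra k A) : Prop :=
  Maximal (fun E' : Subalgebra k A => IsField E') E

/-- `Max(D)`: the set of `k`-isomorphism classes of maximal subfields of `D`, where `D` is given
by its isomorphism class. -/
def maxSpectrum {k : Type u} [Field k] (D : AlgClass k) : Set (AlgClass k) :=
  {L | ∃ A : AlgCat.{u} k, D = algClass k A ∧
    ∃ E : Subalgebra k A, IsMaximalSubfield k E ∧ L = algClass k E}

/-- Linked algebras: they share a common maximal subfield, up to `k`-isomorphism. -/
def Linked {k : Type u} [Field k] (D D' : AlgClass k) : Prop :=
  (maxSpectrum D ∩ maxSpectrum D').Nonempty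

/-- Weakly isomorphic algebras: they have the same maximal subfield spectrum. -/
def WeaklyIsomorphic {k : Type u} [Field k] (D D' : AlgClass k) : Prop :=
  maxSpectrum D = maxSpectrum D'

/-- Extension of scalars `D ↦ K ⊗ D` on isomorphism classes of algebras. -/
def scalarExt (k K : Type u) [Field k] [Field K] [Algebra k K] : AlgClass k → AlgClass K :=
  Quotient.map (fun A : AlgCat.{u} k => AlgCat.of K (K ⊗[k] A))
    (fun _ _ ⟨e⟩ => ⟨Algebra.TensorProduct.congr (AlgEquiv.refl : K ≃ₐ[K] K) e⟩)

/-! It suffices to enlarge `k` until every quaternion algebra contains a square root of every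
non-square: the spectrum of each division quaternion algebra over `K` then consists of all quadratic
extensions. Zorn's lemma builds `K` by adjoining generic solutions of `a x² + b y² - a b z² = d`,
with `x`, `y` independent variables and `d` a non-square.

The crux, `NormAnisotropic.adjoin_generic_solution`, is that no division quaternion algebra splits
on the way. Adjoining `x` and `y` is harmless. If adjoining `z` splits the algebra, its pure form
represents `z² = b⁻¹x² + a⁻¹y² - d/(ab)` over `K(x, y)`. Cassels–Pfister then yields over `K(y)`
anticommuting quaternions with squares `b⁻¹` and `a⁻¹y² - d/(ab)`. Comparison with a presentation
`(b⁻¹, c)` over `K` makes `c (a⁻¹y² - d/(ab))` a norm from `K(y)(√b⁻¹)`; a second use of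
Cassels–Pfister and a determinant make `d` a square.

Linkage serves injectivity: linked algebras are `(d, c)` and `(d, c')`, isomorphic exactly when `(d,
cc')` splits, and `(d, cc')` stays division over `K` if it is so over `k`. -/

/-! ### Anisotropic diagonal forms and the Cassels–Pfister theorem. -/

section DiagonalForms

open Polynomial

/-- The diagonal quadratic form `∑ cᵢ vᵢ²` has no nontrivial zero. -/
def DiagAnisotropic {K ι : Type*} [Field K] [Fintype ι] (c : ι → K) : Prop :=
  ∀ v : ι → K, ∑ i, c i * v i ^ 2 = 0 → v = 0

variable {K ι : Type*} [Field K] [Fintype ι] {c : ι → K}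

theorem coeff_sum_C_mul_sq {p : ι → K[X]} {n : ℕ} (hp : ∀ i, (p i).natDegree ≤ n) :
    (∑ i, C (c i) * p i ^ 2).coeff (2 * n) = ∑ i, c i * (p i).coeff n ^ 2 := by
  simp only [finsetSum_coeff, coeff_C_mul]
  refine Finset.sum_congr rfl fun i _ => ?_
  rw [coeff_pow_of_natDegree_le (hp i)]

/-- At the largest degree `n` of the `p i` the coefficients form a nonzero vector, so by anisotropy
the coefficient of degree `2 * n` cannot cancel. -/
theorem DiagAnisotropic.natDegree_le (hc : DiagAnisotropic c) {p : ι → K[X]} {m : ℕ}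
    (hp : (∑ i, C (c i) * p i ^ 2).natDegree ≤ 2 * m) (i : ι) : (p i).natDegree ≤ m := by
  by_contra! hi
  set n := Finset.univ.sup fun j => (p j).natDegree with hn
  have hle : ∀ j, (p j).natDegree ≤ n := fun j =>
    Finset.le_sup (f := fun j => (p j).natDegree) (Finset.mem_univ j)
  have hmn : m < n := hi.trans_le (hle i)
  obtain ⟨j, -, hj⟩ := Finset.exists_mem_eq_sup Finset.univ ⟨i, Finset.mem_univ i⟩
    fun j => (p j).natDegree
  have h0 := coeff_sum_C_mul_sq (c := c) hle
  rw [coeff_eq_zero_of_natDegree_lt (by omega)] at h0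
  have hcj : (p j).coeff n = 0 := congrFun (hc (fun j => (p j).coeff n) h0.symm) j
  rw [hn, hj, coeff_natDegree, leadingCoeff_eq_zero] at hcj
  rw [hcj, natDegree_zero] at hj
  omega

theorem DiagAnisotropic.polynomial_eq_zero (hc : DiagAnisotropic c) {p : ι → K[X]}
    (hp : ∑ i, C (c i) * p i ^ 2 = 0) : p = 0 := by
  have hd : ∀ i, (p i).natDegree ≤ 0 := hc.natDegree_le (by simp [hp])
  have h0 := coeff_sum_C_mul_sq (c := c) hd
  rw [hp, coeff_zero] at h0
  funext i
  rw [eq_C_of_natDegree_le_zero (hd i)]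
  simpa using congrFun (hc (fun j => (p j).coeff 0) h0.symm) i

/-- **Cassels–Pfister theorem** for anisotropic diagonal forms: a polynomial that is represented
over the field of rational functions is represented over the polynomial ring. -/
theorem DiagAnisotropic.cassels_pfister (hc : DiagAnisotropic c) (g : K[X]) :
    ∀ (n : ℕ) (h : K[X]) (p : ι → K[X]), h.natDegree = n → h ≠ 0 →
      ∑ i, C (c i) * p i ^ 2 = h ^ 2 * g → ∃ q : ι → K[X], ∑ i, C (c i) * q i ^ 2 = g := by
  intro n
  induction n using Nat.strong_induction_on with
  | _ n ih =>
  intro h p hn hh hp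
  set m : ι → K[X] := fun i => p i / h with hm
  set r : ι → K[X] := fun i => p i % h with hr
  have hpmr : ∀ i, p i = h * m i + r i := fun i => (EuclideanDomain.div_add_mod (p i) h).symm
  set Smm := ∑ i, C (c i) * m i ^ 2 with hSmm
  set Smr := ∑ i, C (c i) * (m i * r i) with hSmr
  set Srr := ∑ i, C (c i) * r i ^ 2 with hSrr
  have hexp : ∀ s t : K[X], ∑ i, C (c i) * (s * m i + t * r i) ^ 2 =
      s ^ 2 * Smm + 2 * s * t * Smr + t ^ 2 * Srr := by
    intro s t
    simp only [hSmm, hSmr, hSrr, Finset.mul_sum, ← Finset.sum_add_distrib]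
    exact Finset.sum_congr rfl fun i _ => by ring
  have hsum : h ^ 2 * Smm + 2 * h * Smr + Srr = h ^ 2 * g := by
    have := hexp h 1
    simp only [one_mul, ← hpmr, hp] at this
    rw [this]; ring
  by_cases hr0 : r = 0
  · refine ⟨m, ?_⟩
    have h1 : Smr = 0 := by simp [hSmr, hr0]
    have h2 : Srr = 0 := by simp [hSrr, hr0]
    rw [h1, h2] at hsum
    exact mul_left_cancel₀ (pow_ne_zero 2 hh) (by linear_combination hsum)
  -- The line through `p / h` and `m` meets the quadric again in a point with denominator `k`. Since
  -- `h * k` is the form at the remainders `r`, the degree drops.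
  · set k := h * g - h * Smm - 2 * Smr with hk
    have hhk : Srr = h * k := by rw [hk]; linear_combination hsum
    have hS0 : Srr ≠ 0 := fun h0 => hr0 (hc.polynomial_eq_zero h0)
    have hk0 : k ≠ 0 := fun h0 => hS0 (by rw [hhk, h0, mul_zero])
    have hn0 : h.natDegree ≠ 0 := by
      intro h0
      apply hr0
      funext i
      obtain ⟨u, hu⟩ := natDegree_eq_zero.1 h0
      have hu0 : u ≠ 0 := by rintro rfl; exact hh (by rw [← hu, C_0])
      have : IsUnit h := by rw [← hu]; exact isUnit_C.2 hu0.isUnit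
      exact EuclideanDomain.mod_eq_zero.2 this.dvd
    have hdr : ∀ i, (r i).natDegree ≤ n - 1 := fun i => by
      have := natDegree_mod_lt (p i) hn0
      simp only [hr]; omega
    have hdS : Srr.natDegree ≤ 2 * (n - 1) := by
      refine natDegree_sum_le_of_forall_le _ _ fun i _ => ?_
      refine (natDegree_C_mul_le _ _).trans (natDegree_pow_le.trans ?_)
      exact Nat.mul_le_mul_left 2 (hdr i)
    have hdk : k.natDegree < n := by
      rw [hhk, natDegree_mul hh hk0] at hdS
      omega
    refine ih _ hdk k (fun i => -k * m i + (g - Smm) * r i) rfl hk0 ?_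
    rw [hexp, hhk, hk]
    ring

variable {L : Type*} [Field L] [Algebra K L] {x : L}

/-- Elements of a simple extension have a common denominator. -/
theorem exists_common_denominator (hgen : ∀ r : L, ∃ p q : K[X], r = aeval x p / aeval x q)
    (v : ι → L) : ∃ (h : K[X]) (p : ι → K[X]), aeval x h ≠ 0 ∧
      ∀ i, aeval x h * v i = aeval x (p i) := by
  classical
  have hgen' : ∀ r : L, ∃ p q : K[X], aeval x q ≠ 0 ∧ aeval x q * r = aeval x p := by
    intro r
    obtain ⟨p, q, rfl⟩ := hgen r
    by_cases hq : aeval x q = 0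
    · exact ⟨0, 1, by simp, by simp [hq]⟩
    · exact ⟨p, q, hq, by field_simp⟩
  choose p q hq hpq using fun i => hgen' (v i)
  refine ⟨∏ i, q i, fun i => p i * ∏ j ∈ Finset.univ.erase i, q j, ?_, fun i => ?_⟩
  · rw [map_prod]; exact Finset.prod_ne_zero_iff.2 fun i _ => hq i
  · rw [← Finset.mul_prod_erase _ _ (Finset.mem_univ i), map_mul, map_mul, ← hpq i]
    ring

/-- An anisotropic form stays anisotropic over a purely transcendental simple extension. -/
theorem DiagAnisotropic.of_transcendental (hc : DiagAnisotropic c) (hx : Transcendental K x)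
    (hgen : ∀ r : L, ∃ p q : K[X], r = aeval x p / aeval x q) :
    DiagAnisotropic fun i => algebraMap K L (c i) := by
  intro v hv
  obtain ⟨h, p, hh, hp⟩ := exists_common_denominator hgen v
  have h0 : ∑ i, C (c i) * p i ^ 2 = 0 := by
    refine transcendental_iff_injective.1 hx ?_
    simp only [map_sum, map_mul, map_pow, aeval_C, ← hp, map_zero, mul_pow]
    rw [← mul_zero (aeval x h ^ 2), ← hv, Finset.mul_sum]
    exact Finset.sum_congr rfl fun i _ => by ring
  have hp0 := hc.polynomial_eq_zero h0
  funext i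
  have := hp i
  rw [hp0] at this
  simpa [hh] using this

/-- If an anisotropic form over `K` represents `α x² + δ` over `K(x)`, then it represents `α` and
`δ` by orthogonal vectors over `K`. -/
theorem DiagAnisotropic.exists_orthogonal (h2 : (2 : K) ≠ 0) (hc : DiagAnisotropic c)
    (hx : Transcendental K x) (hgen : ∀ r : L, ∃ p q : K[X], r = aeval x p / aeval x q)
    {α δ : K} {v : ι → L}
    (hv : ∑ i, algebraMap K L (c i) * v i ^ 2 = algebraMap K L α * x ^ 2 + algebraMap K L δ) :
    ∃ w₁ w₀ : ι → K, ∑ i, c i * w₁ i ^ 2 = α ∧ ∑ i, c i * w₀ i ^ 2 = δ ∧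
      ∑ i, c i * (w₁ i * w₀ i) = 0 := by
  obtain ⟨h, p, hh, hp⟩ := exists_common_denominator hgen v
  have h0 : ∑ i, C (c i) * p i ^ 2 = h ^ 2 * (C α * X ^ 2 + C δ) := by
    refine transcendental_iff_injective.1 hx ?_
    simp only [map_sum, map_mul, map_pow, map_add, aeval_C, aeval_X, ← hp, mul_pow]
    rw [← hv, Finset.mul_sum]
    exact Finset.sum_congr rfl fun i _ => by ring
  -- The polynomial vector `q` has degree at most one; its two coefficient vectors are the ones
  -- sought, and the vanishing middle coefficient is their orthogonality.
  obtain ⟨q, hq⟩ := hc.cassels_pfister _ _ h p rfl (fun h0 => hh (by simp [h0])) h0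
  have hd : ∀ i, (q i).natDegree ≤ 1 := hc.natDegree_le (by rw [hq]; compute_degree)
  have hq' : ∀ i, q i = C ((q i).coeff 1) * X + C ((q i).coeff 0) := fun i =>
    eq_X_add_C_of_natDegree_le_one (hd i)
  set w₁ : ι → K := fun i => (q i).coeff 1
  set w₀ : ι → K := fun i => (q i).coeff 0
  have key : C (∑ i, c i * w₁ i ^ 2) * X ^ 2 + C (2 * ∑ i, c i * (w₁ i * w₀ i)) * X +
      C (∑ i, c i * w₀ i ^ 2) = C α * X ^ 2 + C (0 : K) * X + C δ := by
    rw [C_0, zero_mul, add_zero, ← hq]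
    simp only [map_sum, map_mul, map_pow, Finset.mul_sum, Finset.sum_mul, ← Finset.sum_add_distrib]
    refine Finset.sum_congr rfl fun i _ => ?_
    conv_rhs => rw [hq' i]
    simp only [w₁, w₀, map_ofNat]
    ring
  refine ⟨w₁, w₀, ?_⟩
  generalize ∑ i, c i * w₁ i ^ 2 = A, ∑ i, c i * w₀ i ^ 2 = D,
    ∑ i, c i * (w₁ i * w₀ i) = B at key
  have hA := congrArg (fun f => coeff f 2) key
  have hD := congrArg (fun f => coeff f 0) key
  have hB := congrArg (fun f => coeff f 1) key
  simp [coeff_X, coeff_C] at hA hD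
  simp [coeff_C, -map_mul, h2] at hB
  exact ⟨hA, hD, hB⟩

end DiagonalForms

/-! ### Quaternion algebras: norm form, pure quaternions, standard generators. -/

section QuaternionAlgebras

variable {K : Type*} [Field K] {a b : K}

/-- The norm form `⟨1, -a, -b, ab⟩` of the quaternion algebra `(a, b / K)` is anisotropic. -/
def NormAnisotropic (a b : K) : Prop :=
  ∀ x y z w : K, x ^ 2 - a * y ^ 2 - b * z ^ 2 + a * b * w ^ 2 = 0 →
    x = 0 ∧ y = 0 ∧ z = 0 ∧ w = 0

theorem normAnisotropic_iff_diagAnisotropic :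
    NormAnisotropic a b ↔ DiagAnisotropic ![1, -a, -b, a * b] := by
  constructor
  · intro h v hv
    simp only [Fin.sum_univ_four, Matrix.cons_val] at hv
    obtain ⟨h0, h1, h2, h3⟩ := h (v 0) (v 1) (v 2) (v 3) (by linear_combination hv)
    funext i
    fin_cases i <;> assumption
  · intro h x y z w hN
    have := h ![x, y, z, w] (by
      simp only [Fin.sum_univ_four, Matrix.cons_val]
      linear_combination hN)
    exact ⟨congrFun this 0, congrFun this 1, congrFun this 2, congrFun this 3⟩

theorem NormAnisotropic.left_ne_zero (h : NormAnisotropic a b) : a ≠ 0 := by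
  rintro rfl
  exact one_ne_zero (h 0 1 0 0 (by ring)).2.1

theorem NormAnisotropic.right_ne_zero (h : NormAnisotropic a b) : b ≠ 0 := by
  rintro rfl
  exact one_ne_zero (h 0 0 1 0 (by ring)).2.2.1

/-- A square root `s` of `d` would give the isotropic vector `(s, x, y, z)` of the norm form. -/
theorem NormAnisotropic.not_isSquare_of_represents (h : NormAnisotropic a b) {d x y z : K}
    (hd : d ≠ 0) (hxyz : a * x ^ 2 + b * y ^ 2 - a * b * z ^ 2 = d) : ¬IsSquare d := by
  rintro ⟨s, rfl⟩
  have := (h s x y z (by linear_combination -hxyz)).1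
  simp [this] at hd

theorem NormAnisotropic.of_map {L : Type*} [Field L] (f : K →+* L)
    (h : NormAnisotropic (f a) (f b)) : NormAnisotropic a b := by
  intro x y z w hN
  have := h (f x) (f y) (f z) (f w) (by simpa using congrArg f hN)
  simpa using this

theorem QuaternionAlgebra.mul_star_eq_norm (q : ℍ[K,a,b]) :
    q * star q = algebraMap K ℍ[K,a,b]
      (q.re ^ 2 - a * q.imI ^ 2 - b * q.imJ ^ 2 + a * b * q.imK ^ 2) := by
  rw [QuaternionAlgebra.algebraMap_eq]
  ext <;> simp <;> ring

theorem QuaternionAlgebra.star_mul_eq_norm (q : ℍ[K,a,b]) :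
    star q * q = algebraMap K ℍ[K,a,b]
      (q.re ^ 2 - a * q.imI ^ 2 - b * q.imJ ^ 2 + a * b * q.imK ^ 2) := by
  rw [QuaternionAlgebra.algebraMap_eq]
  ext <;> simp <;> ring

theorem NormAnisotropic.isUnit (h : NormAnisotropic a b) {q : ℍ[K,a,b]} (hq : q ≠ 0) :
    IsUnit q := by
  set n := q.re ^ 2 - a * q.imI ^ 2 - b * q.imJ ^ 2 + a * b * q.imK ^ 2 with hn
  have hn0 : n ≠ 0 := by
    intro h0
    obtain ⟨h0, h1, h2, h3⟩ := h _ _ _ _ h0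
    exact hq (by ext <;> simpa)
  refine isUnit_iff_exists.2 ⟨n⁻¹ • star q, ?_, ?_⟩
  · rw [mul_smul_comm, QuaternionAlgebra.mul_star_eq_norm, ← hn, Algebra.smul_def, ← map_mul,
      inv_mul_cancel₀ hn0, map_one]
  · rw [smul_mul_assoc, QuaternionAlgebra.star_mul_eq_norm, ← hn, Algebra.smul_def, ← map_mul,
      inv_mul_cancel₀ hn0, map_one]

theorem normAnisotropic_of_isUnit (h : ∀ q : ℍ[K,a,b], q ≠ 0 → IsUnit q) :
    NormAnisotropic a b := by
  intro x y z w hN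
  set q : ℍ[K,a,b] := ⟨x, y, z, w⟩ with hq
  have h0 : q * star q = 0 := by
    rw [QuaternionAlgebra.mul_star_eq_norm]
    simp only [hq, hN, map_zero]
  have hq0 : q = 0 := by
    by_contra hne
    have hs : star q = 0 := (h q hne).mul_right_eq_zero.1 h0
    exact hne (by simpa using hs)
  rw [QuaternionAlgebra.ext_iff] at hq0
  simpa [hq] using hq0

/-- The conjugates of `q` by `1, i, j, k` sum to four times its scalar part. As the kernel is an
ideal, this applies to `q`, `q * i`, `q * j`, `q * k` and kills every coordinate. -/
theorem QuaternionAlgebra.algHom_injective (h2 : (2 : K) ≠ 0) (ha : a ≠ 0) (hb : b ≠ 0)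
    {A : Type*} [Ring A] [Nontrivial A] [Algebra K A] (f : ℍ[K,a,b] →ₐ[K] A) :
    Function.Injective f := by
  set i : ℍ[K,a,b] := ⟨0, 1, 0, 0⟩ with hi
  set j : ℍ[K,a,b] := ⟨0, 0, 1, 0⟩ with hj
  set k : ℍ[K,a,b] := ⟨0, 0, 0, 1⟩ with hk
  have re_eq : ∀ q : ℍ[K,a,b], f q = 0 → q.re = 0 := by
    intro q hq
    have h4 : q + a⁻¹ • (i * q * i) + b⁻¹ • (j * q * j) - (a * b)⁻¹ • (k * q * k) =
        algebraMap K ℍ[K,a,b] (2 * 2 * q.re) := by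
      rw [QuaternionAlgebra.algebraMap_eq]
      ext <;> simp [hi, hj, hk] <;> field_simp <;> ring
    have := congrArg f h4
    simp only [map_sub, map_add, map_smul, map_mul, hq, mul_zero, zero_mul, smul_zero, add_zero,
      sub_zero, AlgHom.commutes] at this
    simpa only [mul_eq_zero, map_eq_zero_iff _ (FaithfulSMul.algebraMap_injective K A), h2,
      ← map_mul, false_or] using this.symm
  rw [injective_iff_map_eq_zero]
  intro q hq
  have h0 := re_eq q hq
  have h1 := re_eq (q * i) (by rw [map_mul, hq, zero_mul])
  have h2 := re_eq (q * j) (by rw [map_mul, hq, zero_mul])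
  have h3 := re_eq (q * k) (by rw [map_mul, hq, zero_mul])
  simp [hi, ha] at h1
  simp [hj, hb] at h2
  simp [hk, ha, hb] at h3
  ext <;> assumption

/-- A pair of anticommuting elements with scalar squares makes a four-dimensional algebra a
quaternion algebra. -/
theorem QuaternionAlgebra.nonempty_algEquiv_of_anticommute (h2 : (2 : K) ≠ 0) (ha : a ≠ 0)
    (hb : b ≠ 0) {A : Type*} [Ring A] [Nontrivial A] [Algebra K A] (hA : Module.finrank K A = 4)
    {v e : A} (hv : v * v = algebraMap K A a) (he : e * e = algebraMap K A b)
    (hve : v * e = -(e * v)) : Nonempty (ℍ[K,a,b] ≃ₐ[K] A) := by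
  let B : QuaternionAlgebra.Basis A a 0 b :=
    { i := v
      j := e
      k := v * e
      i_mul_i := by rw [hv, zero_smul, add_zero, Algebra.algebraMap_eq_smul_one]
      j_mul_j := by rw [he, Algebra.algebraMap_eq_smul_one]
      i_mul_j := rfl
      j_mul_i := by rw [hve]; simp }
  have hinj := QuaternionAlgebra.algHom_injective h2 ha hb B.liftHom
  have : FiniteDimensional K A := Module.finite_of_finrank_pos (by omega)
  exact ⟨AlgEquiv.ofBijective B.liftHom ⟨hinj,
    (LinearMap.injective_iff_surjective_of_finrank_eq_finrank (f := B.liftHom.toLinearMap)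
      (by rw [QuaternionAlgebra.finrank_eq_four, hA])).1 hinj⟩⟩

/-- If the scalar part were nonzero, the pure part would vanish and `d` would be a square in `K`.
Square roots of `d` thus become representations by the pure form `⟨a, b, -ab⟩`. -/
theorem QuaternionAlgebra.mul_self_eq_iff_of_not_isSquare (h2 : (2 : K) ≠ 0) {d : K}
    (hd : ¬IsSquare d) (q : ℍ[K,a,b]) : q * q = algebraMap K ℍ[K,a,b] d ↔
      q.re = 0 ∧ a * q.imI ^ 2 + b * q.imJ ^ 2 - a * b * q.imK ^ 2 = d := by
  rw [QuaternionAlgebra.algebraMap_eq, QuaternionAlgebra.ext_iff]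
  simp only [QuaternionAlgebra.re_mul, QuaternionAlgebra.imI_mul, QuaternionAlgebra.imJ_mul,
    QuaternionAlgebra.imK_mul]
  constructor
  · rintro ⟨hr, hi, hj, hk⟩
    have hi' : 2 * (q.re * q.imI) = 0 := by linear_combination hi
    have hj' : 2 * (q.re * q.imJ) = 0 := by linear_combination hj
    have hk' : 2 * (q.re * q.imK) = 0 := by linear_combination hk
    have h0 : q.re = 0 := by
      by_contra h0
      simp only [mul_eq_zero, h2, h0, false_or] at hi' hj' hk'
      rw [hi', hj', hk'] at hr
      exact hd ⟨q.re, by linear_combination -hr⟩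
    rw [h0] at hr
    exact ⟨h0, by linear_combination hr⟩
  · rintro ⟨h0, hr⟩
    rw [h0]
    exact ⟨by linear_combination hr, by ring, by ring, by ring⟩

/-- The centralizer of a non-scalar pure quaternion. -/
theorem QuaternionAlgebra.exists_eq_of_commute (h2 : (2 : K) ≠ 0) (ha : a ≠ 0) (hb : b ≠ 0)
    {d : K} (hd : ¬IsSquare d) {v u : ℍ[K,a,b]} (hv : v * v = algebraMap K ℍ[K,a,b] d)
    (huv : u * v = v * u) : ∃ s t : K, u = algebraMap K ℍ[K,a,b] s + t • v := by
  obtain ⟨hv0, hvd⟩ := (QuaternionAlgebra.mul_self_eq_iff_of_not_isSquare h2 hd v).1 hv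
  rw [QuaternionAlgebra.ext_iff] at huv
  simp only [QuaternionAlgebra.re_mul, QuaternionAlgebra.imI_mul, QuaternionAlgebra.imJ_mul,
    QuaternionAlgebra.imK_mul, hv0] at huv
  obtain ⟨-, h1, h3, h4⟩ := huv
  have e1 : u.imJ * v.imK = u.imK * v.imJ :=
    mul_left_cancel₀ (mul_ne_zero h2 hb) (by linear_combination -h1)
  have e2 : u.imI * v.imK = u.imK * v.imI :=
    mul_left_cancel₀ (mul_ne_zero h2 ha) (by linear_combination h3)
  have e3 : u.imI * v.imJ = u.imJ * v.imI :=
    mul_left_cancel₀ h2 (by linear_combination h4)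
  have hne : v.imI ≠ 0 ∨ v.imJ ≠ 0 ∨ v.imK ≠ 0 := by
    by_contra! h
    rw [h.1, h.2.1, h.2.2] at hvd
    exact hd ⟨0, by linear_combination -hvd⟩
  have key : ∃ t : K, u.imI = t * v.imI ∧ u.imJ = t * v.imJ ∧ u.imK = t * v.imK := by
    rcases hne with h | h | h
    · refine ⟨u.imI / v.imI, ?_, ?_, ?_⟩ <;> field_simp
      · linear_combination -e3
      · linear_combination -e2
    · refine ⟨u.imJ / v.imJ, ?_, ?_, ?_⟩ <;> field_simp
      · linear_combination e3
      · linear_combination -e1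
    · refine ⟨u.imK / v.imK, ?_, ?_, ?_⟩ <;> field_simp
      · linear_combination e2
      · linear_combination e1
  obtain ⟨t, hI, hJ, hK⟩ := key
  refine ⟨u.re, t, ?_⟩
  rw [QuaternionAlgebra.algebraMap_eq]
  ext <;> simp [hv0, hI, hJ, hK]

/-- Every non-scalar pure quaternion is the first element of a standard pair of generators. -/
theorem NormAnisotropic.exists_anticommute (h2 : (2 : K) ≠ 0) (h : NormAnisotropic a b)
    {d : K} (hd : ¬IsSquare d) {v : ℍ[K,a,b]} (hv : v * v = algebraMap K ℍ[K,a,b] d) :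
    ∃ (c : K) (e : ℍ[K,a,b]), c ≠ 0 ∧ e * e = algebraMap K ℍ[K,a,b] c ∧ v * e = -(e * v) := by
  obtain ⟨hv0, hvd⟩ := (QuaternionAlgebra.mul_self_eq_iff_of_not_isSquare h2 hd v).1 hv
  have hcomm : ∃ u : ℍ[K,a,b], v * u - u * v ≠ 0 := by
    by_contra! hc
    have hi := hc ⟨0, 1, 0, 0⟩
    have hj := hc ⟨0, 0, 1, 0⟩
    obtain ⟨s, t, hi⟩ := QuaternionAlgebra.exists_eq_of_commute h2 h.left_ne_zero h.right_ne_zero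
      hd hv (sub_eq_zero.1 hi).symm
    obtain ⟨s', t', hj⟩ := QuaternionAlgebra.exists_eq_of_commute h2 h.left_ne_zero h.right_ne_zero
      hd hv (sub_eq_zero.1 hj).symm
    rw [QuaternionAlgebra.algebraMap_eq, QuaternionAlgebra.ext_iff] at hi hj
    simp at hi hj
    obtain ⟨-, hi1, hi2, -⟩ := hi
    obtain ⟨-, hj1, hj2, -⟩ := hj
    rcases hi2 with h0 | h0
    · simp [h0] at hi1
    · simp [h0] at hj2
  obtain ⟨u, hu⟩ := hcomm
  -- As `v * v` is central, a commutator with `v` anticommutes with `v`; being pure, it has scalar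
  -- square.
  set e := v * u - u * v with he
  have he0 : e.re = 0 := by simp [he]; ring
  have hee : e * e = algebraMap K ℍ[K,a,b]
      (a * e.imI ^ 2 + b * e.imJ ^ 2 - a * b * e.imK ^ 2) := by
    rw [QuaternionAlgebra.algebraMap_eq]
    ext <;> simp [he0] <;> ring
  refine ⟨_, e, fun hc => ?_, hee, ?_⟩
  · rw [hc, map_zero] at hee
    exact hu ((h.isUnit hu).mul_right_eq_zero.1 hee)
  · rw [he, mul_sub, sub_mul, ← mul_assoc, mul_assoc u v v, hv, mul_assoc v u v,
      ← Algebra.commutes d u]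
    abel

/-- If `(α, r)` and `(α, c)` both present the same division quaternion algebra, then `c r` is a
norm from `K(√α)`. -/
theorem NormAnisotropic.exists_norm_eq (h2 : (2 : K) ≠ 0) (h : NormAnisotropic a b)
    {α c r : K} (hα : ¬IsSquare α) {v e w u : ℍ[K,a,b]}
    (hv : v * v = algebraMap K ℍ[K,a,b] α) (he : e * e = algebraMap K ℍ[K,a,b] c)
    (hve : v * e = -(e * v)) (hw : w * w = algebraMap K ℍ[K,a,b] α)
    (hu : u * u = algebraMap K ℍ[K,a,b] r) (hwu : w * u = -(u * w)) :
    ∃ s t : K, s ^ 2 - α * t ^ 2 = c * r := by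
  have hα0 : α ≠ 0 := fun h0 => hα ⟨0, by simp [h0]⟩
  have hinj := FaithfulSMul.algebraMap_injective K ℍ[K,a,b]
  -- conjugate `w` to `v`
  obtain ⟨u', hu', hvu'⟩ : ∃ u' : ℍ[K,a,b], u' * u' = algebraMap K ℍ[K,a,b] r ∧
      v * u' = -(u' * v) := by
    -- Skolem–Noether by hand: `g = v * w + α` satisfies `v * g = g * w`, and is invertible unless
    -- zero, when `w = -v`.
    by_cases hvw : v * w + algebraMap K ℍ[K,a,b] α = 0
    · refine ⟨u, hu, ?_⟩
      have h1 : α • (w + v) = 0 := by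
        have := congrArg (v * ·) hvw
        simp only [mul_add, ← mul_assoc, hv, mul_zero] at this
        rw [Algebra.smul_def, mul_add, this.symm, Algebra.commutes α v]
      have h3 : v = -w := by
        have := (smul_eq_zero.1 h1).resolve_left hα0
        exact (eq_neg_of_add_eq_zero_right this)
      rw [h3, neg_mul, hwu, mul_neg]
    · obtain ⟨g, hg⟩ := h.isUnit hvw
      have hvg : v * g = g * w := by
        rw [hg, mul_add, add_mul, ← mul_assoc, hv, mul_assoc v w w, hw, ← Algebra.commutes α v,
          add_comm]
      have hvg' : ↑g⁻¹ * v = w * ↑g⁻¹ := by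
        rw [Units.inv_mul_eq_iff_eq_mul, ← mul_assoc, Units.eq_mul_inv_iff_mul_eq, hvg]
      refine ⟨g * u * ↑g⁻¹, ?_, ?_⟩
      · rw [show (g : ℍ[K,a,b]) * u * ↑g⁻¹ * (g * u * ↑g⁻¹) = g * u * (↑g⁻¹ * g) * u * ↑g⁻¹ by
          noncomm_ring, Units.inv_mul, mul_one, mul_assoc (g : ℍ[K,a,b]) u u, hu,
          ← Algebra.commutes r (g : ℍ[K,a,b]), mul_assoc, Units.mul_inv, mul_one]
      · rw [← mul_assoc, ← mul_assoc, hvg, mul_assoc _ _ v, hvg', mul_assoc _ w u, hwu]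
        noncomm_ring
  -- `u' * e` commutes with `v`, so it is `s + t v`; moving `u'` across turns `u' (u' e) e = c r`
  -- into `(s - t v)(s + t v)`.
  obtain ⟨s, t, hst⟩ := QuaternionAlgebra.exists_eq_of_commute h2 h.left_ne_zero h.right_ne_zero
    hα hv (u := u' * e) (by rw [mul_assoc, ← mul_assoc v, hvu', neg_mul, mul_assoc u' v, hve]; simp)
  refine ⟨s, t, hinj ?_⟩
  have h1 : u' * (u' * e) * e = algebraMap K ℍ[K,a,b] (c * r) := by
    rw [← mul_assoc, mul_assoc, he, hu', ← map_mul, mul_comm]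
  have h3 : u' * (algebraMap K ℍ[K,a,b] s + t • v) =
      (algebraMap K ℍ[K,a,b] s - t • v) * u' := by
    rw [mul_add, sub_mul, Algebra.commutes s u', mul_smul_comm, smul_mul_assoc, hvu', smul_neg,
      sub_neg_eq_add]
  rw [← h1, hst, h3, mul_assoc, hst, sub_mul, mul_add, mul_add, smul_mul_smul_comm, hv,
    Algebra.smul_def t v, Algebra.smul_def, ← mul_assoc, mul_assoc _ v,
    ← Algebra.commutes s v]
  simp only [map_sub, map_mul, pow_two]
  have h4 : algebraMap K ℍ[K,a,b] (α * t * t) =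
      algebraMap K ℍ[K,a,b] t * algebraMap K ℍ[K,a,b] t * algebraMap K ℍ[K,a,b] α := by
    rw [← map_mul, ← map_mul]; congr 1; ring
  rw [← mul_assoc, ← mul_assoc, ← map_mul, ← map_mul, ← map_mul, ← map_mul, ← map_mul, mul_comm s t,
    h4]
  abel

end QuaternionAlgebras

/-! ### Division algebras survive a generic solution. -/

section GenericSolution

open Polynomial IntermediateField

theorem NormAnisotropic.diagAnisotropic_pure {K : Type*} [Field K] {a b : K}
    (h : NormAnisotropic a b) : DiagAnisotropic ![a, b, -(a * b)] := by
  intro v hv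
  simp only [Fin.sum_univ_three, Matrix.cons_val] at hv
  obtain ⟨-, h1, h2, h3⟩ := h 0 (v 0) (v 1) (v 2) (by linear_combination -hv)
  funext i
  fin_cases i <;> assumption

theorem NormAnisotropic.of_transcendental {K L : Type*} [Field K] [Field L] [Algebra K L] {x : L}
    {a b : K} (h : NormAnisotropic a b) (hx : Transcendental K x)
    (hgen : ∀ r : L, ∃ p q : K[X], r = aeval x p / aeval x q) :
    NormAnisotropic (algebraMap K L a) (algebraMap K L b) := by
  rw [normAnisotropic_iff_diagAnisotropic] at h ⊢
  convert h.of_transcendental hx hgen using 1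
  funext i
  fin_cases i <;> simp

/-- A division quaternion algebra that splits over a quadratic extension generated by a square
root of `g` has a pure quaternion with square `g`. -/
theorem NormAnisotropic.exists_represents {L M : Type*} [Field L] [Field M] [Algebra L M]
    {a b g : L} (h2 : (2 : L) ≠ 0) (h : NormAnisotropic a b) {z : M}
    (hz : z ^ 2 = algebraMap L M g)
    (hgen : ∀ r : M, ∃ p q : L, r = algebraMap L M p + algebraMap L M q * z)
    (hM : ¬NormAnisotropic (algebraMap L M a) (algebraMap L M b)) :
    ∃ x y w : L, a * x ^ 2 + b * y ^ 2 - a * b * w ^ 2 = g := by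
  have hinj := FaithfulSMul.algebraMap_injective L M
  have hzL : ∀ s : L, z ≠ algebraMap L M s := by
    rintro s rfl
    refine hM fun x y w t hN => ?_
    have hsurj : ∀ r : M, ∃ p : L, r = algebraMap L M p := fun r => by
      obtain ⟨p, q, hr⟩ := hgen r
      exact ⟨p + q * s, by rw [hr]; simp⟩
    obtain ⟨x, rfl⟩ := hsurj x
    obtain ⟨y, rfl⟩ := hsurj y
    obtain ⟨w, rfl⟩ := hsurj w
    obtain ⟨t, rfl⟩ := hsurj t
    simpa using h x y w t (hinj (by simpa using hN))
  have hind : ∀ p q : L, algebraMap L M p + algebraMap L M q * z = 0 → p = 0 ∧ q = 0 := by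
    intro p q hpq
    have hq : q = 0 := by
      by_contra hq
      refine hzL (-p / q) ?_
      have : algebraMap L M q ≠ 0 := by simpa using hq
      simp only [map_div₀, map_neg]
      field_simp
      linear_combination hpq
    subst hq
    exact ⟨by simpa using hpq, rfl⟩
  simp only [NormAnisotropic, not_forall] at hM
  obtain ⟨r₀, r₁, r₂, r₃, hN, hne⟩ := hM
  obtain ⟨p₀, q₀, rfl⟩ := hgen r₀
  obtain ⟨p₁, q₁, rfl⟩ := hgen r₁
  obtain ⟨p₂, q₂, rfl⟩ := hgen r₂
  obtain ⟨p₃, q₃, rfl⟩ := hgen r₃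
  -- With `N` the norm form and `B` its polar form, the norm of `p + q z` is `N(p) + g N(q) + 2 B(p,
  -- q) z`, and `1`, `z` are independent.
  obtain ⟨hre, him⟩ := hind
    ((p₀ ^ 2 - a * p₁ ^ 2 - b * p₂ ^ 2 + a * b * p₃ ^ 2) +
      g * (q₀ ^ 2 - a * q₁ ^ 2 - b * q₂ ^ 2 + a * b * q₃ ^ 2))
    (2 * (p₀ * q₀ - a * (p₁ * q₁) - b * (p₂ * q₂) + a * b * (p₃ * q₃))) (by
      simp only [map_add, map_sub, map_mul, map_pow, map_ofNat, ← hz]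
      linear_combination hN)
  have hB := (mul_eq_zero.1 him).resolve_left h2
  set n := q₀ ^ 2 - a * q₁ ^ 2 - b * q₂ ^ 2 + a * b * q₃ ^ 2 with hn
  have hn0 : n ≠ 0 := by
    intro h0
    obtain ⟨rfl, rfl, rfl, rfl⟩ := h _ _ _ _ (hn ▸ h0)
    rw [h0, mul_zero, add_zero] at hre
    obtain ⟨rfl, rfl, rfl, rfl⟩ := h _ _ _ _ hre
    simp at hne
  -- These are the coordinates of the quaternion `p q⁻¹`: it is pure because `B(p, q) = 0`, and its
  -- norm is `N(p) / N(q) = -g`.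
  refine ⟨(p₁ * q₀ - p₀ * q₁ + b * (p₂ * q₃ - p₃ * q₂)) / n,
    (p₂ * q₀ - p₀ * q₂ + a * (p₃ * q₁ - p₁ * q₃)) / n,
    (p₃ * q₀ - p₀ * q₃ - p₁ * q₂ + p₂ * q₁) / n, ?_⟩
  field_simp
  rw [hn]
  linear_combination (p₀ * q₀ - a * (p₁ * q₁) - b * (p₂ * q₂) + a * b * (p₃ * q₃)) * hB -
    n * hre

/-- If the pure form of a division quaternion algebra represents `α x² + β y² + γ` over `K(x, y)`,
then `-αβγ` is a square. -/
theorem NormAnisotropic.isSquare_of_represents {K K₁ K₂ : Type*} [Field K] [Field K₁] [Field K₂]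
    [Algebra K K₁] [Algebra K₁ K₂] (h2 : (2 : K) ≠ 0) {a b α β γ : K} (h : NormAnisotropic a b)
    (hα : α ≠ 0) {y : K₁} (hy : Transcendental K y)
    (hygen : ∀ r : K₁, ∃ p q : K[X], r = aeval y p / aeval y q)
    {x : K₂} (hx : Transcendental K₁ x)
    (hxgen : ∀ r : K₂, ∃ p q : K₁[X], r = aeval x p / aeval x q)
    {v : Fin 3 → K₂}
    (hv : ∑ i, algebraMap K₁ K₂ (algebraMap K K₁ (![a, b, -(a * b)] i)) * v i ^ 2 =
      algebraMap K₁ K₂ (algebraMap K K₁ α) * x ^ 2 +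
        algebraMap K₁ K₂ (algebraMap K K₁ β * y ^ 2 + algebraMap K K₁ γ)) :
    IsSquare (-(α * β * γ)) := by
  have h2' : (2 : K₁) ≠ 0 := by
    rw [← map_ofNat (algebraMap K K₁) 2]
    exact (_root_.map_ne_zero _).2 h2
  have h₁ := h.of_transcendental hy hygen
  have hd := h.diagAnisotropic_pure
  obtain ⟨w₁, w₀, hw₁, hw₀, hw⟩ := (hd.of_transcendental hy hygen).exists_orthogonal h2' hx hxgen hv
  -- `α` is already represented over `K`
  obtain ⟨-, v, -, hv, -⟩ := hd.exists_orthogonal h2 hy hygen (α := 0) (δ := α) (v := w₁)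
    (by rw [hw₁]; simp)
  simp only [Fin.sum_univ_three, Matrix.cons_val, map_neg, map_mul] at hw₁ hw₀ hw hv
  have hαK : ¬IsSquare α :=
    h.not_isSquare_of_represents (x := v 0) (y := v 1) (z := v 2) hα (by linear_combination hv)
  have hαK₁ : ¬IsSquare (algebraMap K K₁ α) :=
    h₁.not_isSquare_of_represents (x := w₁ 0) (y := w₁ 1) (z := w₁ 2) (by simpa using hα)
      (by linear_combination hw₁)
  -- Over `K` the algebra is `(α, c)`; over `K₁` the pure quaternions `w₁`, `w₀` anticommute and
  -- have squares `α` and `β y² + γ`.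
  obtain ⟨c, e, hc, he, hve⟩ := h.exists_anticommute h2 hαK (v := ⟨0, v 0, v 1, v 2⟩)
    ((QuaternionAlgebra.mul_self_eq_iff_of_not_isSquare h2 hαK _).2
      ⟨rfl, by linear_combination hv⟩)
  have hc' : algebraMap K K₁ c ≠ 0 := by simpa using hc
  obtain ⟨s, t, hst⟩ := h₁.exists_norm_eq h2' (c := algebraMap K K₁ c)
    (r := algebraMap K K₁ β * y ^ 2 + algebraMap K K₁ γ) hαK₁
    (v := ⟨0, algebraMap K K₁ (v 0), algebraMap K K₁ (v 1), algebraMap K K₁ (v 2)⟩)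
    (e := ⟨algebraMap K K₁ e.re, algebraMap K K₁ e.imI, algebraMap K K₁ e.imJ,
      algebraMap K K₁ e.imK⟩)
    (w := ⟨0, w₁ 0, w₁ 1, w₁ 2⟩) (u := ⟨0, w₀ 0, w₀ 1, w₀ 2⟩)
    ((QuaternionAlgebra.mul_self_eq_iff_of_not_isSquare h2' hαK₁ _).2
      ⟨rfl, by simp only [← hv, map_add, map_mul, map_pow, map_neg]; ring⟩)
    (by
      rw [QuaternionAlgebra.algebraMap_eq, QuaternionAlgebra.ext_iff] at he ⊢
      simp only [QuaternionAlgebra.re_mul, QuaternionAlgebra.imI_mul, QuaternionAlgebra.imJ_mul,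
        QuaternionAlgebra.imK_mul] at he ⊢
      obtain ⟨e0, e1, e2, e3⟩ := he
      have e0 := congrArg (algebraMap K K₁) e0
      have e1 := congrArg (algebraMap K K₁) e1
      have e2 := congrArg (algebraMap K K₁) e2
      have e3 := congrArg (algebraMap K K₁) e3
      simp only [map_add, map_sub, map_mul, map_zero] at e0 e1 e2 e3
      exact ⟨by linear_combination e0, by linear_combination e1, by linear_combination e2,
        by linear_combination e3⟩)
    (by
      rw [QuaternionAlgebra.ext_iff] at hve ⊢
      simp only [QuaternionAlgebra.re_mul, QuaternionAlgebra.imI_mul, QuaternionAlgebra.imJ_mul,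
        QuaternionAlgebra.imK_mul, QuaternionAlgebra.re_neg, QuaternionAlgebra.imI_neg,
        QuaternionAlgebra.imJ_neg, QuaternionAlgebra.imK_neg] at hve ⊢
      obtain ⟨e0, e1, e2, e3⟩ := hve
      have e0 := congrArg (algebraMap K K₁) e0
      have e1 := congrArg (algebraMap K K₁) e1
      have e2 := congrArg (algebraMap K K₁) e2
      have e3 := congrArg (algebraMap K K₁) e3
      simp only [map_add, map_sub, map_mul, map_zero, map_neg] at e0 e1 e2 e3
      exact ⟨by linear_combination e0, by linear_combination e1, by linear_combination e2,
        by linear_combination e3⟩)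
    ((QuaternionAlgebra.mul_self_eq_iff_of_not_isSquare h2' hαK₁ _).2
      ⟨rfl, by linear_combination hw₁⟩)
    (by
      rw [QuaternionAlgebra.algebraMap_eq]
      ext <;> simp
      · linear_combination hw₀
      · ring
      · ring
      · ring)
    (by
      ext <;> simp
      · linear_combination 2 * hw
      · ring
      · ring
      · ring)
  -- By `hst` this binary form represents `β y² + γ` over `K₁`; being anisotropic, it represents `β`
  -- and `γ` orthogonally over `K`.
  have hd2 : DiagAnisotropic ![c⁻¹, -(c⁻¹ * α)] := by
    intro f hf
    simp only [Fin.sum_univ_two, Matrix.cons_val] at hf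
    have hf' : f 0 ^ 2 = α * f 1 ^ 2 := by field_simp at hf; linear_combination hf
    have h1 : f 1 = 0 := by
      by_contra h1
      exact hαK ⟨f 0 / f 1, by field_simp; linear_combination -hf'⟩
    have h0 : f 0 = 0 := by simpa [h1] using hf'
    funext i
    fin_cases i <;> assumption
  obtain ⟨f₁, f₀, hf₁, hf₀, hf⟩ := hd2.exists_orthogonal h2 hy hygen (α := β) (δ := γ)
    (v := ![s, t]) (by
      simp only [Fin.sum_univ_two, Matrix.cons_val, map_neg, map_mul, map_inv₀]
      field_simp
      linear_combination hst)
  simp only [Fin.sum_univ_two, Matrix.cons_val] at hf₁ hf₀ hf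
  -- Gram determinant: `β γ` is the determinant `-α c⁻²` of the form times the squared determinant
  -- of `f₁, f₀`.
  refine ⟨α * c⁻¹ * (f₁ 0 * f₀ 1 - f₁ 1 * f₀ 0), ?_⟩
  rw [← hf₁, ← hf₀]
  field_simp at hf ⊢
  linear_combination (-(f₁ 0 * f₀ 0 - α * (f₁ 1 * f₀ 1))) * hf

theorem IntermediateField.exists_eq_div_of_adjoin_simple {F E : Type*} [Field F] [Field E]
    [Algebra F E] (x : E) (r : F⟮x⟯) :
    ∃ p q : F[X], r = aeval (AdjoinSimple.gen F x) p / aeval (AdjoinSimple.gen F x) q := by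
  obtain ⟨p, q, hr⟩ := (mem_adjoin_simple_iff F (r : E)).1 r.2
  refine ⟨p, q, (algebraMap F⟮x⟯ E).injective ?_⟩
  rw [map_div₀, ← aeval_algebraMap_apply, ← aeval_algebraMap_apply, AdjoinSimple.algebraMap_gen]
  exact hr

theorem IntermediateField.exists_eq_add_mul_of_sq_mem {F E : Type*} [Field F] [Field E]
    [Algebra F E] {z : E} {g : F} (hz : z ^ 2 = algebraMap F E g) (r : F⟮z⟯) :
    ∃ p q : F, r = algebraMap F F⟮z⟯ p + algebraMap F F⟮z⟯ q * AdjoinSimple.gen F z := by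
  have hint : IsIntegral F z := ⟨X ^ 2 - C g, monic_X_pow_sub_C g two_ne_zero, by simp [hz]⟩
  have hr : (r : E) ∈ Algebra.adjoin F {z} := by
    rw [← adjoin_simple_toSubalgebra_of_isAlgebraic hint.isAlgebraic]
    exact r.2
  suffices ∃ p q : F, (r : E) = algebraMap F E p + algebraMap F E q * z by
    obtain ⟨p, q, h⟩ := this
    exact ⟨p, q, Subtype.ext (by simpa using h)⟩
  generalize (r : E) = r at hr
  induction hr using Algebra.adjoin_induction with
  | mem x hx => exact ⟨0, 1, by simp [Set.mem_singleton_iff.1 hx]⟩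
  | algebraMap p => exact ⟨p, 0, by simp⟩
  | add x y _ _ hx hy =>
    obtain ⟨p, q, rfl⟩ := hx
    obtain ⟨p', q', rfl⟩ := hy
    exact ⟨p + p', q + q', by simp only [map_add]; ring⟩
  | mul x y _ _ hx hy =>
    obtain ⟨p, q, rfl⟩ := hx
    obtain ⟨p', q', rfl⟩ := hy
    exact ⟨p * p' + q * q' * g, p * q' + q * p', by
      simp only [map_add, map_mul, ← hz]; ring⟩

/-- Adjoining a generic solution of `a x² + b y² - ab z² = d`, where `d` is not a square, keeps all
division quaternion algebras division algebras. -/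
theorem NormAnisotropic.adjoin_generic_solution {K Ω : Type*} [Field K] [Field Ω] [Algebra K Ω]
    (h2 : (2 : K) ≠ 0) {a b d : K} (ha : a ≠ 0) (hb : b ≠ 0) (hd : ¬IsSquare d) {x y z : Ω}
    (hy : Transcendental K y) (hx : Transcendental K⟮y⟯ x)
    (hz : algebraMap K Ω a * x ^ 2 + algebraMap K Ω b * y ^ 2 -
      algebraMap K Ω a * algebraMap K Ω b * z ^ 2 = algebraMap K Ω d)
    {a' b' : K} (h : NormAnisotropic a' b') :
    NormAnisotropic
      (algebraMap K⟮y⟯⟮x⟯ K⟮y⟯⟮x⟯⟮z⟯ (algebraMap K⟮y⟯ K⟮y⟯⟮x⟯ (algebraMap K K⟮y⟯ a')))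
      (algebraMap K⟮y⟯⟮x⟯ K⟮y⟯⟮x⟯⟮z⟯ (algebraMap K⟮y⟯ K⟮y⟯⟮x⟯ (algebraMap K K⟮y⟯ b'))) := by
  have hy' : Transcendental K (AdjoinSimple.gen K y) := fun hA => hy (by
    simpa using hA.algebraMap (A := Ω))
  have hx' : Transcendental K⟮y⟯ (AdjoinSimple.gen K⟮y⟯ x) := fun hA => hx (by
    simpa using hA.algebraMap (A := Ω))
  have h₂ := (h.of_transcendental hy' (exists_eq_div_of_adjoin_simple y)).of_transcendental hx'
    (exists_eq_div_of_adjoin_simple x)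
  have ha' : algebraMap K Ω a ≠ 0 := by simpa using ha
  have hb' : algebraMap K Ω b ≠ 0 := by simpa using hb
  have h2₂ : (2 : K⟮y⟯⟮x⟯) ≠ 0 := by
    rw [← map_ofNat (algebraMap K K⟮y⟯⟮x⟯) 2]
    exact (_root_.map_ne_zero _).2 h2
  by_contra hM
  set g : K⟮y⟯⟮x⟯ := algebraMap K⟮y⟯ K⟮y⟯⟮x⟯ (algebraMap K K⟮y⟯ b⁻¹) * AdjoinSimple.gen K⟮y⟯ x ^ 2 +
    algebraMap K⟮y⟯ K⟮y⟯⟮x⟯ (algebraMap K K⟮y⟯ a⁻¹ * AdjoinSimple.gen K y ^ 2 +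
      algebraMap K K⟮y⟯ (-(d * (a * b)⁻¹))) with hg
  have hzg : z ^ 2 = algebraMap K⟮y⟯⟮x⟯ Ω g := by
    have : algebraMap K⟮y⟯⟮x⟯ Ω g = algebraMap K Ω b⁻¹ * x ^ 2 +
      (algebraMap K Ω a⁻¹ * y ^ 2 + algebraMap K Ω (-(d * (a * b)⁻¹))) := by
      simp only [hg, map_add, map_mul, map_pow]
      rfl
    rw [this]
    simp only [map_inv₀, map_neg, map_mul]
    field_simp
    linear_combination -hz
  have hzg' : AdjoinSimple.gen K⟮y⟯⟮x⟯ z ^ 2 = algebraMap K⟮y⟯⟮x⟯ K⟮y⟯⟮x⟯⟮z⟯ g :=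
    Subtype.ext hzg
  obtain ⟨p, q, r, hpqr⟩ := h₂.exists_represents h2₂ hzg' (exists_eq_add_mul_of_sq_mem hzg) hM
  -- With `α = b⁻¹`, `β = a⁻¹`, `γ = -d / (a b)`, the element `-(α β γ)` is `d / (a b)²`.
  obtain ⟨s, hs⟩ := h.isSquare_of_represents h2 (inv_ne_zero hb) hy'
    (exists_eq_div_of_adjoin_simple y) hx' (exists_eq_div_of_adjoin_simple x) (v := ![p, q, r])
    (by
      rw [← hg, ← hpqr]
      simp only [Fin.sum_univ_three, Matrix.cons_val, map_neg, map_mul]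
      ring)
  refine hd ⟨s * (a * b), ?_⟩
  field_simp at hs
  linear_combination hs

end GenericSolution

/-! ### Iterating generic solutions inside a large algebraically closed field. -/

section ClosedExtension

open IntermediateField

theorem Transcendental.of_forall_algebraMap_mem {F K Ω : Type*} [Field F] [Field K] [Field Ω]
    [Algebra F Ω] [Algebra K Ω] {C : IntermediateField F Ω} (h : ∀ r : K, algebraMap K Ω r ∈ C)
    {y : Ω} (hy : Transcendental C y) : Transcendental K y := by
  let f : K →+* C := (algebraMap K Ω).codRestrict C h
  let _ := f.toAlgebra
  have : IsScalarTower K C Ω := .of_algebraMap_eq fun _ => rfl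
  exact fun hK => hy (hK.tower_top C)

/-- The relative algebraic closure of the subfield generated by the `s i` with `i ∈ W`. -/
def relClosure (k : Type*) {Ω I : Type*} [Field k] [Field Ω] [Algebra k Ω] (s : I → Ω)
    (W : Set I) : IntermediateField k Ω :=
  (algebraicClosure (adjoin k (s '' W)) Ω).restrictScalars k

section RelClosure

variable {k Ω I : Type*} [Field k] [Field Ω] [Algebra k Ω] {s : I → Ω}

theorem mem_relClosure {W : Set I} {x : Ω} :
    x ∈ relClosure k s W ↔ IsAlgebraic (adjoin k (s '' W)) x :=
  mem_algebraicClosure_iff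

theorem relClosure_mono {W W' : Set I} (h : W ⊆ W') : relClosure k s W ≤ relClosure k s W' := by
  intro x hx
  rw [mem_relClosure] at hx ⊢
  have hle : adjoin k (s '' W) ≤ adjoin k (s '' W') := adjoin.mono k _ _ (Set.image_mono h)
  let _ := (inclusion hle).toRingHom.toAlgebra
  have : IsScalarTower (adjoin k (s '' W)) (adjoin k (s '' W')) Ω := .of_algebraMap_eq fun _ => rfl
  exact hx.tower_top _

theorem apply_mem_relClosure {W : Set I} {i : I} (hi : i ∈ W) : s i ∈ relClosure k s W :=
  mem_relClosure.2 (isAlgebraic_algebraMap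
    (⟨s i, subset_adjoin k _ (Set.mem_image_of_mem s hi)⟩ : adjoin k (s '' W)))

theorem mem_relClosure_of_sq_mem {W : Set I} {z : Ω} (hz : z ^ 2 ∈ relClosure k s W) :
    z ∈ relClosure k s W :=
  mem_relClosure.2 ((mem_relClosure.1 hz).of_pow two_pos)

theorem AlgebraicIndependent.transcendental_relClosure (hs : AlgebraicIndependent k s) {W : Set I}
    {i : I} (hi : i ∉ W) : Transcendental (relClosure k s W) (s i) :=
  (IntermediateField.transcendental_adjoin_iff.2 (hs.transcendental_adjoin hi)).algebraicClosure

end RelClosure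

/-- Each triple `(a, b, d)` in `Ω` owns two variables, so the Zorn argument never runs out. This is
possible because `Ω` has the infinite cardinality of `k × ℕ`, hence as many elements as `Ω³ × Bool`.
-/
theorem exists_algebraicIndependent_of_self (k : Type u) [Field k] :
    ∃ (Ω : Type u) (_ : Field Ω) (_ : Algebra k Ω) (s : (Ω × Ω × Ω) × Bool → Ω),
      IsAlgClosed Ω ∧ AlgebraicIndependent k s := by
  let I := k × ℕ
  let R := MvPolynomial I k
  let Ω := AlgebraicClosure (FractionRing R)
  have hX : IsTranscendenceBasis k (algebraMap R Ω ∘ MvPolynomial.X) := by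
    have : Algebra.IsAlgebraic R (FractionRing R) :=
      IsLocalization.isAlgebraic (FractionRing R) (nonZeroDivisors R)
    have : FaithfulSMul R Ω := by
      rw [faithfulSMul_iff_algebraMap_injective, IsScalarTower.algebraMap_eq R (FractionRing R) Ω]
      exact (algebraMap (FractionRing R) Ω).injective.comp (IsFractionRing.injective R _)
    have : Algebra.IsAlgebraic R Ω :=
      Algebra.IsAlgebraic.trans R (FractionRing R) Ω
    exact (IsTranscendenceBasis.mvPolynomial I k).algebraMap_comp
  have hI : Cardinal.aleph0 ≤ Cardinal.mk I := Cardinal.aleph0_le_mk I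
  have hkI : Cardinal.mk k ≤ Cardinal.mk I :=
    Cardinal.mk_le_of_injective (f := fun x : k => ((x, 0) : I)) fun _ _ h => (Prod.ext_iff.1 h).1
  have hΩ : Cardinal.mk Ω = Cardinal.mk I := by
    have := hX.lift_cardinalMk_eq_max_lift
    simp only [Cardinal.lift_id] at this
    rw [this, max_eq_right hkI, max_eq_left hI]
  have hle : Cardinal.mk ((Ω × Ω × Ω) × Bool) ≤ Cardinal.mk I := by
    simp only [Cardinal.mk_prod, Cardinal.lift_id, hΩ, Cardinal.mul_eq_self hI, Cardinal.mk_bool,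
      Cardinal.lift_uzero]
    rw [Cardinal.lift_ofNat, Cardinal.mul_eq_left hI ((Cardinal.ofNat_lt_aleph0).le.trans hI)
      two_ne_zero]
  obtain ⟨τ⟩ := hle
  exact ⟨Ω, inferInstance, inferInstance, _ ∘ τ, inferInstance, hX.1.comp τ τ.injective⟩

/-- One extension step inside `Ω`. -/
theorem exists_extension_solving {k Ω : Type*} [Field k] [Field Ω] [Algebra k Ω] [IsAlgClosed Ω]
    (h2 : (2 : k) ≠ 0) {s : (Ω × Ω × Ω) × Bool → Ω} (hs : AlgebraicIndependent k s)
    {K : IntermediateField k Ω} {J : Set (Ω × Ω × Ω)} (hK : K ≤ relClosure k s (J ×ˢ Set.univ))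
    {a b d : K} (ha : a ≠ 0) (hb : b ≠ 0) (hd : ¬IsSquare d)
    (he : ((a : Ω), (b : Ω), (d : Ω)) ∉ J) :
    ∃ K' : IntermediateField k Ω, K ≤ K' ∧
      K' ≤ relClosure k s (insert ((a : Ω), (b : Ω), (d : Ω)) J ×ˢ Set.univ) ∧
      (∀ a' b' : k, NormAnisotropic (algebraMap k K a') (algebraMap k K b') →
        NormAnisotropic (algebraMap k K' a') (algebraMap k K' b')) ∧
      ∃ x ∈ K', ∃ y ∈ K', ∃ z ∈ K', (a : Ω) * x ^ 2 + b * y ^ 2 - a * b * z ^ 2 = d := by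
  set e : Ω × Ω × Ω := ((a : Ω), (b : Ω), (d : Ω)) with hedef
  set x := s (e, true) with hxdef
  set y := s (e, false) with hydef
  set C := relClosure k s (insert e J ×ˢ Set.univ) with hC
  have h2K : (2 : K) ≠ 0 := by
    rw [← map_ofNat (algebraMap k K) 2]
    exact (map_ne_zero _).2 h2
  have ha' : (a : Ω) ≠ 0 := by simpa using ha
  have hb' : (b : Ω) ≠ 0 := by simpa using hb
  obtain ⟨z, hz⟩ := IsAlgClosed.exists_pow_nat_eq (((a : Ω) * x ^ 2 + b * y ^ 2 - d) / (a * b))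
    two_pos
  have hxyz : (a : Ω) * x ^ 2 + b * y ^ 2 - a * b * z ^ 2 = d := by
    rw [hz]; field_simp; ring
  have hKC : K ≤ C := hK.trans (relClosure_mono (Set.prod_mono_left (Set.subset_insert e J)))
  have hyC : y ∈ C := apply_mem_relClosure ⟨Set.mem_insert e J, trivial⟩
  have hxC : x ∈ C := apply_mem_relClosure ⟨Set.mem_insert e J, trivial⟩
  have hzC : z ∈ C := by
    refine mem_relClosure_of_sq_mem ?_
    rw [hz]
    exact div_mem (sub_mem (add_mem (mul_mem (hKC a.2) (pow_mem hxC 2))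
      (mul_mem (hKC b.2) (pow_mem hyC 2))) (hKC d.2)) (mul_mem (hKC a.2) (hKC b.2))
  have hy : Transcendental K y :=
    (hs.transcendental_relClosure (W := J ×ˢ Set.univ) (i := (e, false))
      fun h => he h.1).of_forall_algebraMap_mem fun r => hK r.2
  have hyle : K⟮y⟯ ≤ extendScalars hKC := by simpa using hyC
  have hx : Transcendental K⟮y⟯ x := by
    set W : Set ((Ω × Ω × Ω) × Bool) := insert (e, false) (J ×ˢ Set.univ) with hW
    have hKW : K ≤ relClosure k s W := hK.trans (relClosure_mono (Set.subset_insert _ _))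
    have hyW : K⟮y⟯ ≤ extendScalars hKW := adjoin_simple_le_iff.2
      (apply_mem_relClosure (k := k) (s := s) (Set.mem_insert (e, false) (J ×ˢ Set.univ)))
    refine (hs.transcendental_relClosure (W := W) (i := (e, true)) ?_).of_forall_algebraMap_mem
      fun r => hyW r.2
    rintro (h | h)
    · simp at h
    · exact he h.1
  have hxle : K⟮y⟯⟮x⟯ ≤ extendScalars hyle := by simpa using hxC
  have hzle : K⟮y⟯⟮x⟯⟮z⟯ ≤ extendScalars hxle := by simpa using hzC
  let K' : IntermediateField k Ω :=
    ((K⟮y⟯⟮x⟯⟮z⟯.restrictScalars K⟮y⟯).restrictScalars K).restrictScalars k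
  have hmem₂ : ∀ r : K⟮y⟯⟮x⟯, (r : Ω) ∈ K' := fun r => K⟮y⟯⟮x⟯⟮z⟯.algebraMap_mem r
  have hmem₁ : ∀ r : K⟮y⟯, (r : Ω) ∈ K' := fun r => hmem₂ (algebraMap K⟮y⟯ K⟮y⟯⟮x⟯ r)
  have hmem₀ : ∀ r : K, (r : Ω) ∈ K' := fun r => hmem₁ (algebraMap K K⟮y⟯ r)
  refine ⟨K', fun r hr => hmem₀ ⟨r, hr⟩, fun r hr => hzle hr, fun a' b' h => ?_,
    x, hmem₂ (AdjoinSimple.gen K⟮y⟯ x), y, hmem₁ (AdjoinSimple.gen K y),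
    z, mem_adjoin_simple_self _ z, hxyz⟩
  exact h.adjoin_generic_solution h2K ha hb hd hy hx hxyz

/-- Every field `k` of characteristic not two has an extension over which all division quaternion
algebras over `k` remain division algebras and all quaternion algebras contain square roots of all
non-squares. -/
theorem exists_extension_forall_represents (k : Type u) [Field k] (h2 : (2 : k) ≠ 0) :
    ∃ (K : Type u) (_ : Field K) (_ : Algebra k K),
      (∀ a b : k, NormAnisotropic a b → NormAnisotropic (algebraMap k K a) (algebraMap k K b)) ∧
      ∀ a b d : K, a ≠ 0 → b ≠ 0 → ¬IsSquare d →
        ∃ x y z : K, a * x ^ 2 + b * y ^ 2 - a * b * z ^ 2 = d := by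
  obtain ⟨Ω, _, _, s, _, hs⟩ := exists_algebraicIndependent_of_self k
  -- The second component records the solved triples; bounding the field by their variables keeps
  -- those of all other triples transcendental over it.
  let S : Set (IntermediateField k Ω × Set (Ω × Ω × Ω)) := {p |
    p.1 ≤ relClosure k s (p.2 ×ˢ Set.univ) ∧
    (∀ a b : k, NormAnisotropic a b →
      NormAnisotropic (algebraMap k p.1 a) (algebraMap k p.1 b)) ∧
    ∀ e ∈ p.2, ∃ x ∈ p.1, ∃ y ∈ p.1, ∃ z ∈ p.1, e.1 * x ^ 2 + e.2.1 * y ^ 2 -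
      e.1 * e.2.1 * z ^ 2 = e.2.2}
  have hbot : ((⊥ : IntermediateField k Ω), (∅ : Set (Ω × Ω × Ω))) ∈ S := by
    refine ⟨bot_le, fun a b h => ?_, fun e he => he.elim⟩
    refine NormAnisotropic.of_map (botEquiv k Ω).toRingEquiv.toRingHom ?_
    simpa using h
  obtain ⟨⟨K, J⟩, -, hmax⟩ := zorn_le_nonempty₀ S (fun c hcS hc p hp => by
    have hne : Nonempty c := ⟨⟨p, hp⟩⟩
    have hdir : Directed (· ≤ ·) fun q : c => q.1.1 := by
      intro q r
      obtain ⟨t, ht, hqt, hrt⟩ := hc.directedOn q.1 q.2 r.1 r.2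
      exact ⟨⟨t, ht⟩, hqt.1, hrt.1⟩
    set U : IntermediateField k Ω := ⨆ q : c, q.1.1 with hU
    have hmem : ∀ x : Ω, x ∈ U ↔ ∃ q ∈ c, x ∈ q.1 := by
      intro x
      rw [hU, ← SetLike.mem_coe, coe_iSup_of_directed hdir]
      simp
    have hle : ∀ q ∈ c, q.1 ≤ U := fun q hq x hx => (hmem x).2 ⟨q, hq, hx⟩
    refine ⟨(U, ⋃ q ∈ c, q.2), ⟨?_, ?_, ?_⟩, fun q hq => ⟨hle q hq, ?_⟩⟩
    · intro x hx
      obtain ⟨q, hq, hxq⟩ := (hmem x).1 hx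
      exact relClosure_mono (Set.prod_mono_left (Set.subset_biUnion_of_mem (u := Prod.snd) hq))
        ((hcS hq).1 hxq)
    -- A zero of the norm form has only four coordinates, so it already lives in one member of the
    -- chain.
    · intro a b h x y z w hN
      obtain ⟨q₁, hq₁, hx⟩ := (hmem x).1 x.2
      obtain ⟨q₂, hq₂, hy⟩ := (hmem y).1 y.2
      obtain ⟨q₃, hq₃, hz⟩ := (hmem z).1 z.2
      obtain ⟨q₄, hq₄, hw⟩ := (hmem w).1 w.2
      obtain ⟨r₁, hr₁, h₁, h₂⟩ := hc.directedOn q₁ hq₁ q₂ hq₂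
      obtain ⟨r₂, hr₂, h₃, h₄⟩ := hc.directedOn q₃ hq₃ q₄ hq₄
      obtain ⟨r, hr, h₅, h₆⟩ := hc.directedOn r₁ hr₁ r₂ hr₂
      obtain ⟨e₁, e₂, e₃, e₄⟩ := (hcS hr).2.1 a b h ⟨x, h₅.1 (h₁.1 hx)⟩ ⟨y, h₅.1 (h₂.1 hy)⟩ ⟨z, h₆.1 (h₃.1 hz)⟩
        ⟨w, h₆.1 (h₄.1 hw)⟩ (Subtype.ext (congrArg (algebraMap U Ω) hN))
      exact ⟨Subtype.ext (congrArg (algebraMap r.1 Ω) e₁),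
        Subtype.ext (congrArg (algebraMap r.1 Ω) e₂), Subtype.ext (congrArg (algebraMap r.1 Ω) e₃),
        Subtype.ext (congrArg (algebraMap r.1 Ω) e₄)⟩
    · intro e he
      simp only [Set.mem_iUnion] at he
      obtain ⟨q, hq, heq⟩ := he
      obtain ⟨x, hx, y, hy, z, hz, h⟩ := (hcS hq).2.2 e heq
      exact ⟨x, hle q hq hx, y, hle q hq hy, z, hle q hq hz, h⟩
    · exact Set.subset_biUnion_of_mem (u := Prod.snd) hq) _ hbot
  obtain ⟨hK, haniso, hJ⟩ := hmax.prop
  refine ⟨K, inferInstance, inferInstance, haniso, fun a b d ha hb hd => ?_⟩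
  by_cases he : ((a : Ω), (b : Ω), (d : Ω)) ∈ J
  · obtain ⟨x, hx, y, hy, z, hz, h⟩ := hJ _ he
    exact ⟨⟨x, hx⟩, ⟨y, hy⟩, ⟨z, hz⟩, Subtype.ext h⟩
  · obtain ⟨K', hKK', hK', han, x, hx, y, hy, z, hz, h⟩ :=
      exists_extension_solving h2 hs hK ha hb hd he
    have hS : (K', insert ((a : Ω), (b : Ω), (d : Ω)) J) ∈ S := by
      refine ⟨hK', fun a b h => han a b (haniso a b h), ?_⟩
      rintro e (rfl | he')
      · exact ⟨x, hx, y, hy, z, hz, h⟩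
      · obtain ⟨x, hx, y, hy, z, hz, h⟩ := hJ e he'
        exact ⟨x, hKK' hx, y, hKK' hy, z, hKK' hz, h⟩
    exact absurd ((hmax.le_of_ge hS ⟨hKK', Set.subset_insert _ _⟩).2 (Set.mem_insert _ _)) he

end ClosedExtension

/-! ### Maximal subfields, common slots and isomorphism criteria. -/

section MaximalSubfields

variable {K : Type u} [Field K] {a b : K} {A : Type u} [Ring A] [Algebra K A]

theorem algClass_eq_iff {B : Type u} [Ring B] [Algebra K B] :
    algClass K A = algClass K B ↔ Nonempty (A ≃ₐ[K] B) :=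
  Quotient.eq (r := algIsoSetoid K)

/-- The homomorphism from `K(√d)` given by a square root of `d`. -/
def sqrtHom {d : K} {v : A} (hv : v * v = algebraMap K A d) : QuadraticAlgebra K d 0 →ₐ[K] A :=
  QuadraticAlgebra.lift ⟨v, by rw [hv, zero_smul, add_zero, Algebra.algebraMap_eq_smul_one]⟩

theorem sqrtHom_apply {d : K} {v : A} (hv : v * v = algebraMap K A d)
    (q : QuadraticAlgebra K d 0) : sqrtHom hv q = algebraMap K A q.re + q.im • v := by
  simp [sqrtHom, QuadraticAlgebra.lift, Algebra.algebraMap_eq_smul_one]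

theorem mem_range_sqrtHom {d : K} {v : A} (hv : v * v = algebraMap K A d) {u : A} :
    u ∈ (sqrtHom hv).range ↔ ∃ s t : K, u = algebraMap K A s + t • v :=
  ⟨fun ⟨q, hq⟩ => ⟨q.re, q.im, hq.symm.trans (sqrtHom_apply hv q)⟩,
    fun ⟨s, t, h⟩ => ⟨⟨s, t⟩, (sqrtHom_apply hv _).trans h.symm⟩⟩

theorem quadraticAlgebra_isField {d : K} (hd : ¬IsSquare d) :
    IsField (QuadraticAlgebra K d 0) := by
  have : Fact (∀ r : K, r ^ 2 ≠ d + 0 * r) := ⟨fun r hr => hd ⟨r, by linear_combination -hr⟩⟩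
  exact Field.toIsField _

theorem sqrtHom_injective [Nontrivial A] {d : K} (hd : ¬IsSquare d) {v : A}
    (hv : v * v = algebraMap K A d) : Function.Injective (sqrtHom hv) := by
  have : Fact (∀ r : K, r ^ 2 ≠ d + 0 * r) := ⟨fun r hr => hd ⟨r, by linear_combination -hr⟩⟩
  exact (sqrtHom hv).toRingHom.injective

/-- The maximal subfields of a division quaternion algebra are its subfields `K(√d)`. -/
theorem NormAnisotropic.isMaximalSubfield_iff (h2 : (2 : K) ≠ 0) (h : NormAnisotropic a b)
    (f : A ≃ₐ[K] ℍ[K,a,b]) (E : Subalgebra K A) :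
    IsMaximalSubfield K E ↔ ∃ (d : K) (v : A) (hv : v * v = algebraMap K A d),
      ¬IsSquare d ∧ E = (sqrtHom hv).range := by
  have : Nontrivial A := f.toEquiv.nontrivial
  have centralizer : ∀ {d : K} {v u : A} (hv : v * v = algebraMap K A d), ¬IsSquare d →
      u * v = v * u → u ∈ (sqrtHom hv).range := by
    intro d v u hv hd huv
    obtain ⟨s, t, hst⟩ := QuaternionAlgebra.exists_eq_of_commute h2 h.left_ne_zero h.right_ne_zero
      hd (v := f v) (u := f u) (by rw [← map_mul, hv, AlgEquiv.commutes])
      (by rw [← map_mul, huv, map_mul])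
    exact (mem_range_sqrtHom hv).2 ⟨s, t, f.injective (by simp [hst])⟩
  have field_range : ∀ {d : K} {v : A} (hv : v * v = algebraMap K A d), ¬IsSquare d →
      IsField (sqrtHom hv).range := fun hv hd =>
    (AlgEquiv.ofInjective _ (sqrtHom_injective hd hv)).toMulEquiv.symm.isField
      (quadraticAlgebra_isField hd)
  have self_mem : ∀ {d : K} {v : A} (hv : v * v = algebraMap K A d), v ∈ (sqrtHom hv).range :=
    fun hv => (mem_range_sqrtHom hv).2 ⟨0, 1, by simp⟩
  -- Subtracting the scalar part leaves a nonzero pure quaternion, whose square is represented by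
  -- the pure form and so is not a square in `K`.
  have pure_part : ∀ w : A, w ∉ (⊥ : Subalgebra K A) → ∃ s d : K,
      (w - algebraMap K A s) * (w - algebraMap K A s) = algebraMap K A d ∧ ¬IsSquare d := by
    intro w hw
    set q := f w with hq
    have hne : q - algebraMap K ℍ[K,a,b] q.re ≠ 0 := by
      intro h0
      refine hw (Algebra.mem_bot.2 ⟨q.re, f.injective ?_⟩)
      rw [AlgEquiv.commutes, ← hq, sub_eq_zero.1 h0]
      simp
    refine ⟨q.re, a * q.imI ^ 2 + b * q.imJ ^ 2 - a * b * q.imK ^ 2, f.injective ?_, ?_⟩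
    · generalize hd : a * q.imI ^ 2 + b * q.imJ ^ 2 - a * b * q.imK ^ 2 = d
      simp only [map_mul, map_sub, AlgEquiv.commutes, ← hq]
      rw [QuaternionAlgebra.algebraMap_eq, QuaternionAlgebra.algebraMap_eq]
      ext <;> simp
      · linear_combination hd
      all_goals ring
    · refine h.not_isSquare_of_represents (fun h0 => hne ?_) rfl
      obtain ⟨-, h1, h2, h3⟩ := h 0 q.imI q.imJ q.imK (by linear_combination -h0)
      rw [QuaternionAlgebra.algebraMap_eq]
      ext <;> simp [h1, h2, h3]
  constructor
  · intro hE
    have hcomm : ∀ x ∈ E, ∀ y ∈ E, x * y = y * x := fun x hx y hy =>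
      congrArg Subtype.val (hE.prop.mul_comm ⟨x, hx⟩ ⟨y, hy⟩)
    obtain ⟨w, hwE, hw⟩ : ∃ w ∈ E, w ∉ (⊥ : Subalgebra K A) := by
      by_contra! hbot
      have hi : f.symm ⟨0, 1, 0, 0⟩ ∉ (⊥ : Subalgebra K A) := by
        intro hi
        obtain ⟨r, hr⟩ := Algebra.mem_bot.1 hi
        have := congrArg f hr
        rw [AlgEquiv.commutes, AlgEquiv.apply_symm_apply, QuaternionAlgebra.algebraMap_eq,
          QuaternionAlgebra.ext_iff] at this
        simp at this
      obtain ⟨s, d, hv, hd⟩ := pure_part _ hi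
      have hle := hE.le_of_ge (field_range hv hd) fun x hx =>
        bot_le (a := (sqrtHom hv).range) (hbot x hx)
      refine hi ?_
      have := add_mem (hbot _ (hle (self_mem hv))) ((⊥ : Subalgebra K A).algebraMap_mem s)
      simpa using this
    obtain ⟨s, d, hv, hd⟩ := pure_part w hw
    refine ⟨d, _, hv, hd, ?_⟩
    have hvE : w - algebraMap K A s ∈ E := sub_mem hwE (E.algebraMap_mem s)
    refine le_antisymm (fun u hu => centralizer hv hd (hcomm _ hu _ hvE)) fun u hu => ?_
    obtain ⟨s', t, rfl⟩ := (mem_range_sqrtHom hv).1 hu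
    exact add_mem (E.algebraMap_mem s') (E.smul_mem hvE t)
  · rintro ⟨d, v, hv, hd, rfl⟩
    refine ⟨field_range hv hd, fun E' hE' hle u hu => centralizer hv hd ?_⟩
    exact congrArg Subtype.val (hE'.mul_comm ⟨u, hu⟩ ⟨v, hle (self_mem hv)⟩)

/-- This reduces comparing spectra to asking which non-squares have square roots in the algebra. -/
theorem NormAnisotropic.mem_maxSpectrum_iff (h2 : (2 : K) ≠ 0) (h : NormAnisotropic a b)
    {L : AlgClass K} : L ∈ maxSpectrum (algClass K ℍ[K,a,b]) ↔
      ∃ d : K, ¬IsSquare d ∧ (∃ v : ℍ[K,a,b], v * v = algebraMap K ℍ[K,a,b] d) ∧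
        L = algClass K (QuadraticAlgebra K d 0) := by
  constructor
  · rintro ⟨A, hA, E, hE, rfl⟩
    obtain ⟨f⟩ := algClass_eq_iff.1 hA.symm
    obtain ⟨d, v, hv, hd, rfl⟩ := (h.isMaximalSubfield_iff h2 f E).1 hE
    have : Nontrivial A := f.toEquiv.nontrivial
    exact ⟨d, hd, ⟨f v, by rw [← map_mul, hv, AlgEquiv.commutes]⟩,
      algClass_eq_iff.2 ⟨(AlgEquiv.ofInjective _ (sqrtHom_injective hd hv)).symm⟩⟩
  · rintro ⟨d, hd, ⟨v, hv⟩, rfl⟩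
    exact ⟨AlgCat.of K ℍ[K,a,b], rfl, (sqrtHom hv).range,
      (h.isMaximalSubfield_iff h2 AlgEquiv.refl _).2 ⟨d, v, hv, hd, rfl⟩,
      algClass_eq_iff.2 ⟨AlgEquiv.ofInjective _ (sqrtHom_injective hd hv)⟩⟩

theorem NormAnisotropic.isDivision (h : NormAnisotropic a b) : IsDivision ℍ[K,a,b] :=
  ⟨inferInstance, fun _ hq => h.isUnit hq⟩

theorem normAnisotropic_of_isDivision (hA : IsDivision A) (f : ℍ[K,a,b] ≃ₐ[K] A) :
    NormAnisotropic a b :=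
  normAnisotropic_of_isUnit fun q hq =>
    (MulEquiv.isUnit_map f).1 (hA.2 (f q) (by simpa using hq))

theorem mem_quatStar_iff {c : AlgClass K} : c ∈ QuatStar K ↔
    ∃ a b : K, NormAnisotropic a b ∧ c = algClass K ℍ[K,a,b] := by
  constructor
  · rintro ⟨⟨a, b, -, -, rfl⟩, A, hA, hdiv⟩
    obtain ⟨f⟩ := algClass_eq_iff.1 hA
    exact ⟨a, b, normAnisotropic_of_isDivision hdiv f, rfl⟩
  · rintro ⟨a, b, h, rfl⟩
    exact ⟨⟨a, b, h.left_ne_zero, h.right_ne_zero, rfl⟩, AlgCat.of K ℍ[K,a,b], rfl, h.isDivision⟩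

/-- Linked division quaternion algebras have presentations with a common slot. -/
theorem NormAnisotropic.exists_common_slot (h2 : (2 : K) ≠ 0) (h : NormAnisotropic a b) {a' b' : K}
    (h' : NormAnisotropic a' b')
    (hl : Linked (algClass K ℍ[K,a,b]) (algClass K ℍ[K,a',b'])) :
    ∃ d c c' : K, ¬IsSquare d ∧ algClass K ℍ[K,a,b] = algClass K ℍ[K,d,c] ∧
      algClass K ℍ[K,a',b'] = algClass K ℍ[K,d,c'] ∧ c ≠ 0 ∧ c' ≠ 0 := by
  obtain ⟨L, hL, hL'⟩ := hl
  obtain ⟨d, hd, ⟨v, hv⟩, rfl⟩ := (h.mem_maxSpectrum_iff h2).1 hL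
  obtain ⟨d', hd', ⟨v', hv'⟩, hdd'⟩ := (h'.mem_maxSpectrum_iff h2).1 hL'
  obtain ⟨f⟩ := algClass_eq_iff.1 hdd'
  have hd0 : d ≠ 0 := fun h0 => hd ⟨0, by simp [h0]⟩
  -- Carrying `√d` through `K(√d) ≃ K(√d')` gives a square root of the same `d` in the second
  -- algebra.
  have hw : sqrtHom hv' (f QuadraticAlgebra.omega) * sqrtHom hv' (f QuadraticAlgebra.omega) =
      algebraMap K ℍ[K,a',b'] d := by
    rw [← map_mul, ← map_mul, QuadraticAlgebra.omega_mul_omega_eq_add]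
    simp [Algebra.algebraMap_eq_smul_one]
  obtain ⟨c, e, hc, he, hve⟩ := h.exists_anticommute h2 hd hv
  obtain ⟨c', e', hc', he', hve'⟩ := h'.exists_anticommute h2 hd hw
  obtain ⟨g⟩ := QuaternionAlgebra.nonempty_algEquiv_of_anticommute h2 hd0 hc
    (QuaternionAlgebra.finrank_eq_four _ _ _) hv he hve
  obtain ⟨g'⟩ := QuaternionAlgebra.nonempty_algEquiv_of_anticommute h2 hd0 hc'
    (QuaternionAlgebra.finrank_eq_four _ _ _) hw he' hve'
  exact ⟨d, c, c', hd, algClass_eq_iff.2 ⟨g.symm⟩, algClass_eq_iff.2 ⟨g'.symm⟩, hc, hc'⟩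

theorem NormAnisotropic.of_algClass_eq (h : NormAnisotropic a b) {a' b' : K}
    (hab : algClass K ℍ[K,a,b] = algClass K ℍ[K,a',b']) : NormAnisotropic a' b' := by
  obtain ⟨f⟩ := algClass_eq_iff.1 hab.symm
  exact normAnisotropic_of_isDivision h.isDivision f

/-- Quaternion algebras `(d, c)` and `(d, c')` are isomorphic if `(d, cc')` splits. -/
theorem algClass_eq_of_not_normAnisotropic (h2 : (2 : K) ≠ 0) {d c c' : K} (hd : ¬IsSquare d)
    (hc : c ≠ 0) (hc' : c' ≠ 0) (h : ¬NormAnisotropic d (c * c')) :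
    algClass K ℍ[K,d,c] = algClass K ℍ[K,d,c'] := by
  have hd0 : d ≠ 0 := fun h0 => hd ⟨0, by simp [h0]⟩
  have hnorm : ∀ s t : K, s ^ 2 - d * t ^ 2 = 0 → s = 0 ∧ t = 0 := by
    intro s t hst
    have ht : t = 0 := by
      by_contra ht
      exact hd ⟨s / t, by field_simp; linear_combination -hst⟩
    subst ht
    exact ⟨by simpa using hst, rfl⟩
  simp only [NormAnisotropic, not_forall] at h
  obtain ⟨x, y, z, w, hN, hne⟩ := h
  set n := z ^ 2 - d * w ^ 2 with hn
  have hN' : x ^ 2 - d * y ^ 2 = c * c' * n := by rw [hn]; linear_combination hN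
  have hn0 : n ≠ 0 := by
    intro h0
    obtain ⟨rfl, rfl⟩ := hnorm z w h0
    rw [h0, mul_zero] at hN'
    obtain ⟨rfl, rfl⟩ := hnorm x y hN'
    simp at hne
  obtain ⟨s, t, hst⟩ : ∃ s t : K, s ^ 2 - d * t ^ 2 = c * c' := by
    -- Norms form a group: this is `(x + y√d) / (z + w√d)`.
    refine ⟨(x * z - d * y * w) / n, (y * z - x * w) / n, ?_⟩
    field_simp
    linear_combination n * hN' - (x ^ 2 - d * y ^ 2) * hn
  -- The new generator `(s/c) j + (t/c) k` has square `(s² - d t²) / c = c'`.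
  obtain ⟨f⟩ := QuaternionAlgebra.nonempty_algEquiv_of_anticommute h2 hd0 hc'
    (A := ℍ[K,d,c]) (QuaternionAlgebra.finrank_eq_four _ _ _)
    (v := ⟨0, 1, 0, 0⟩) (e := ⟨0, 0, s / c, t / c⟩)
    (by rw [QuaternionAlgebra.algebraMap_eq]; ext <;> simp)
    (by
      rw [QuaternionAlgebra.algebraMap_eq]
      ext <;> simp
      · field_simp; linear_combination hst
      · ring)
    (by ext <;> simp)
  exact algClass_eq_iff.2 ⟨f.symm⟩

/-- Two presentations with slot `d` make `c c'` a norm `s² - d t²`, so `(s, t, 1, 0)` is isotropic.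
-/
theorem NormAnisotropic.not_normAnisotropic_of_algClass_eq (h2 : (2 : K) ≠ 0) {d c c' : K}
    (hd : ¬IsSquare d) (h : NormAnisotropic d c')
    (hcc' : algClass K ℍ[K,d,c] = algClass K ℍ[K,d,c']) : ¬NormAnisotropic d (c * c') := by
  intro hN
  obtain ⟨f⟩ := algClass_eq_iff.1 hcc'
  have hii : ∀ e : K, (⟨0, 1, 0, 0⟩ : ℍ[K,d,e]) * ⟨0, 1, 0, 0⟩ = algebraMap K ℍ[K,d,e] d := by
    intro e
    rw [QuaternionAlgebra.algebraMap_eq]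
    ext <;> simp
  have hjj : ∀ e : K, (⟨0, 0, 1, 0⟩ : ℍ[K,d,e]) * ⟨0, 0, 1, 0⟩ = algebraMap K ℍ[K,d,e] e := by
    intro e
    rw [QuaternionAlgebra.algebraMap_eq]
    ext <;> simp
  have hij : ∀ e : K, (⟨0, 1, 0, 0⟩ : ℍ[K,d,e]) * ⟨0, 0, 1, 0⟩ =
      -(⟨0, 0, 1, 0⟩ * ⟨0, 1, 0, 0⟩) := by
    intro e
    ext <;> simp
  obtain ⟨s, t, hst⟩ := h.exists_norm_eq h2 hd (hii c') (hjj c') (hij c')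
    (w := f ⟨0, 1, 0, 0⟩) (u := f ⟨0, 0, 1, 0⟩) (r := c)
    (by rw [← map_mul, hii, AlgEquiv.commutes]) (by rw [← map_mul, hjj, AlgEquiv.commutes])
    (by rw [← map_mul, hij, map_neg, map_mul])
  exact one_ne_zero (hN s t 1 0 (by linear_combination hst)).2.2.1

end MaximalSubfields

/-! ### Scalar extension and the main theorem. -/

theorem scalarExt_algClass_quaternionAlgebra {k K : Type u} [Field k] [Field K] [Algebra k K]
    (h2 : (2 : k) ≠ 0) {a b : k} (ha : a ≠ 0) (hb : b ≠ 0) :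
    scalarExt k K (algClass k ℍ[k,a,b]) =
      algClass K ℍ[K,algebraMap k K a,algebraMap k K b] := by
  have h2' : (2 : K) ≠ 0 := by
    rw [← map_ofNat (algebraMap k K) 2]
    exact (map_ne_zero _).2 h2
  obtain ⟨f⟩ := QuaternionAlgebra.nonempty_algEquiv_of_anticommute (A := K ⊗[k] ℍ[k,a,b])
    (a := algebraMap k K a) (b := algebraMap k K b) h2' (by simpa using ha) (by simpa using hb)
    (by rw [Module.finrank_baseChange, QuaternionAlgebra.finrank_eq_four])
    (v := 1 ⊗ₜ ⟨0, 1, 0, 0⟩) (e := 1 ⊗ₜ ⟨0, 0, 1, 0⟩)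
    (by
      rw [Algebra.TensorProduct.tmul_mul_tmul, ← IsScalarTower.algebraMap_apply,
        Algebra.TensorProduct.algebraMap_apply', mul_one]
      congr 1
      rw [QuaternionAlgebra.algebraMap_eq]
      ext <;> simp)
    (by
      rw [Algebra.TensorProduct.tmul_mul_tmul, ← IsScalarTower.algebraMap_apply,
        Algebra.TensorProduct.algebraMap_apply', mul_one]
      congr 1
      rw [QuaternionAlgebra.algebraMap_eq]
      ext <;> simp)
    (by
      rw [Algebra.TensorProduct.tmul_mul_tmul, Algebra.TensorProduct.tmul_mul_tmul,
        ← TensorProduct.tmul_neg]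
      congr 1
      ext <;> simp)
  exact algClass_eq_iff.2 ⟨f.symm⟩

theorem theorem3p2 {k : Type u} [Field k] (hk : ringChar k ≠ 2)
    (𝒟 : Set (AlgClass k)) (h𝒟 : 𝒟 ⊆ QuatStar k) (hlinked : 𝒟.Pairwise Linked) :
    ∃ (K : Type u) (_ : Field K) (_ : Algebra k K),
      Set.MapsTo (scalarExt k K) 𝒟 (QuatStar K) ∧
      Set.InjOn (scalarExt k K) 𝒟 ∧
      (scalarExt k K '' 𝒟).Pairwise WeaklyIsomorphic := by
  have h2 : (2 : k) ≠ 0 := Ring.two_ne_zero hk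
  obtain ⟨K, _, _, hK, hrep⟩ := exists_extension_forall_represents k h2
  have h2K : (2 : K) ≠ 0 := by
    rw [← map_ofNat (algebraMap k K) 2]
    exact (map_ne_zero _).2 h2
  have hext : ∀ D ∈ 𝒟, ∃ a b : K, NormAnisotropic a b ∧ scalarExt k K D = algClass K ℍ[K,a,b] := by
    intro D hD
    obtain ⟨a, b, h, rfl⟩ := mem_quatStar_iff.1 (h𝒟 hD)
    exact ⟨_, _, hK a b h,
      scalarExt_algClass_quaternionAlgebra h2 h.left_ne_zero h.right_ne_zero⟩
  refine ⟨K, inferInstance, inferInstance, fun D hD => mem_quatStar_iff.2 (hext D hD), ?_, ?_⟩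
  · intro D hD D' hD' heq
    by_contra hne
    obtain ⟨a, b, h, hDab⟩ := mem_quatStar_iff.1 (h𝒟 hD)
    obtain ⟨a', b', h', hDab'⟩ := mem_quatStar_iff.1 (h𝒟 hD')
    have hl := hlinked hD hD' hne
    rw [hDab, hDab'] at hl hne heq
    obtain ⟨d, c, c', hd, hc, hc', hc0, hc0'⟩ := h.exists_common_slot h2 h' hl
    have hd0 : d ≠ 0 := fun h0 => hd ⟨0, by simp [h0]⟩
    -- The algebra `(d, cc')` detects non-isomorphism; it remains division over `K`, whereas `heq`
    -- would split it there.
    have hcc' : NormAnisotropic d (c * c') := by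
      by_contra hN
      exact hne (by rw [hc, hc', algClass_eq_of_not_normAnisotropic h2 hd hc0 hc0' hN])
    have hdc' := hK _ _ (h'.of_algClass_eq hc')
    rw [hc, hc', scalarExt_algClass_quaternionAlgebra h2 hd0 hc0,
      scalarExt_algClass_quaternionAlgebra h2 hd0 hc0'] at heq
    refine hdc'.not_normAnisotropic_of_algClass_eq h2K ?_ heq (by simpa using hK _ _ hcc')
    exact hdc'.not_isSquare_of_represents (x := 1) (y := 0) (z := 0) (by simpa using hd0) (by ring)
  -- The right-hand side does not involve `D`: every non-square of `K` has a square root in the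
  -- extended algebra.
  · have hspec : ∀ D ∈ 𝒟, maxSpectrum (scalarExt k K D) =
        {L | ∃ d : K, ¬IsSquare d ∧ L = algClass K (QuadraticAlgebra K d 0)} := by
      intro D hD
      obtain ⟨a, b, h, hDab⟩ := hext D hD
      ext L
      rw [hDab, h.mem_maxSpectrum_iff h2K]
      refine exists_congr fun d => and_congr_right fun hd => and_iff_right ?_
      obtain ⟨x, y, z, hxyz⟩ := hrep a b d h.left_ne_zero h.right_ne_zero hd
      exact ⟨⟨0, x, y, z⟩,
        (QuaternionAlgebra.mul_self_eq_iff_of_not_isSquare h2K hd _).2 ⟨rfl, hxyz⟩⟩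
    rintro _ ⟨D, hD, rfl⟩ _ ⟨D', hD', rfl⟩ -
    exact (hspec D hD).trans (hspec D' hD').symm
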